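/- Let $k$ be a field and let $n\ge 1$. All manifolds are compact, smooth and oriented, and may be empty or disconnected; closed manifolds have no boundary. A cobordism $M:\Sigma_0\rightsquigarrow\Sigma_1$ between closed $(n-1)$-manifolds is an $n$-manifold $M$ with $\partial M=\partial_{\mathrm{in}}M\sqcup\partial_{\mathrm{out}}M$ and orientation-preserving diffeomorphisms $\Sigma_0\to\overline{\partial_{\mathrm{in}}M}$ and $\Sigma_1\to\partial_{\mathrm{out}}M$. Two cobordisms $\Sigma_0\rightsquigarrow\Sigma_1$ are equivalent if there is an orientation-preserving diffeomorphism between them that commutes with these boundary diffeomorphisms. An $n$-dimensional oriented TQFT over $k$ is a symmetric monoidal functor $\mathcal T$ from $n$-dimensional cobordisms to $k$-vector spaces: it assigns a vector space $\mathcal T(\Sigma)$ to each closed $(n-1)$-manifold $\Sigma$ and a linear map $\mathcal T(M):\mathcal T(\Sigma_0)\to\mathcal T(\Sigma_1)$ to each cobordism $M:\Sigma_0\rightsquigarrow\Sigma_1$, such that equivalent cobordisms have the same image, gluing goes to composition, cylinders go to identity maps, disjoint unions of $(n-1)$-manifolds and of cobordisms go to tensor products (compatibly with the associativity, unit and symmetry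 isomorphisms), and $\mathcal T(\emptyset)=k$. Consider the TQFTs with $\mathcal T(\Sigma)=k$ for all $\Sigma$, where the identification $\mathcal T(\Sigma)\otimes\mathcal T(\Sigma')=\mathcal T(\Sigma\sqcup\Sigma')$ is the multiplication $k\otimes k=k$. Two of them are regarded as equal if they assign the same linear map $k\to k$ to every cobordism (they are not identified when they are merely naturally isomorphic). They form a commutative monoid under the tensor product, $(\mathcal T\otimes\mathcal T')(M)=\mathcal T(M)\otimes\mathcal T'(M)$, whose unit is the trivial TQFT, which sends every cobordism to $\mathrm{id}_k$. Let $\mathbf{nTQFT}_k^\times$ be the group of invertible elements of this monoid, and let $\mathscr T^n_k\subseteq\mathbf{nTQFT}_k^\times$ be the subgroup of all $\mathcal T$ such that $\mathcal T(M)=\mathrm{id}_k$ for every $n$-dimensional cobordism $M$ with empty boundary. Theorem. The group $\mathscr T^n_k$ is trivial if and only if the group $k^\times$ is trivial. -/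

import Mathlib

open scoped Manifold ContDiff TensorProduct Topology

noncomputable section

/-! ### Orientations -/

section LinearAlgebra

variable {E E' : Type*} [AddCommGroup E] [Module ℝ E] [AddCommGroup E'] [Module ℝ E']

/-- The linear map `L` is an isomorphism that carries the orientation `o` to `o'`. -/
def PreservesOrientation {ι : Type*} (L : E →ₗ[ℝ] E')
    (o : Orientation ℝ E ι) (o' : Orientation ℝ E' ι) : Prop :=
  ∃ e : E ≃ₗ[ℝ] E', (e : E →ₗ[ℝ] E') = L ∧ Orientation.map ι e o = o'

/-- `L : E → E'` is the inclusion of a hyperplane, `v` is transverse to it, and the orientation `o`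
of `E` is the one for which `(v, L b₁, …, L b_d)` is positive for `o'` whenever `(b₁, …, b_d)` is
positive for `o`. Orientations are rays of volume forms, so that this says that `o` is the ray of
`η (v, L ·, …, L ·)` when `o'` is the ray of `η`; for `d = 0` the orientation `o` is a sign. -/
def InducesOrientation {d : ℕ} (L : E →ₗ[ℝ] E') (v : E')
    (o : Orientation ℝ E (Fin d)) (o' : Orientation ℝ E' (Fin (d + 1))) : Prop :=
  ∃ (η : E' [⋀^Fin (d + 1)]→ₗ[ℝ] ℝ) (hη : η ≠ 0) (hL : (η.curryLeft v).compLinearMap L ≠ 0),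
    o' = rayOfNeZero ℝ η hη ∧ o = rayOfNeZero ℝ ((η.curryLeft v).compLinearMap L) hL

end LinearAlgebra

section Manifold

variable {E : Type*} [NormedAddCommGroup E] [NormedSpace ℝ E] {H : Type*} [TopologicalSpace H]

/-- A choice of orientations of the tangent spaces is continuous if it is locally constant
in charts. -/
def IsContinuousOrientation {ι : Type*} (I : ModelWithCorners ℝ E H) {M : Type*}
    [TopologicalSpace M] [ChartedSpace H M] [IsManifold I ∞ M]
    (o : ∀ x : M, Orientation ℝ (TangentSpace I x) ι) : Prop :=
  ∀ x : M, ∀ᶠ y in 𝓝 x,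
    PreservesOrientation (tangentCoordChange I y x y : E →ₗ[ℝ] E) (o y) (o x)

variable {M N : Type*} [TopologicalSpace M] [ChartedSpace H M] [TopologicalSpace N]
  [ChartedSpace H N]

/-- An orientation of a disjoint union, from orientations of the two parts. -/
def sumOrientation {ι : Type*} (I : ModelWithCorners ℝ E H)
    (o : ∀ x : M, Orientation ℝ (TangentSpace I x) ι)
    (o' : ∀ x : N, Orientation ℝ (TangentSpace I x) ι) :
    ∀ x : M ⊕ N, Orientation ℝ (TangentSpace I x) ι
  | Sum.inl x => o x
  | Sum.inr x => o' x

end Manifold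

/-! ### Closed manifolds and cobordisms -/

/-- The half-space `ℝ^d × [0, ∞)`, on which `(d + 1)`-manifolds with boundary are modelled. -/
abbrev halfSpaceModel (d : ℕ) :
    ModelWithCorners ℝ (EuclideanSpace ℝ (Fin d) × EuclideanSpace ℝ (Fin 1))
      (ModelProd (EuclideanSpace ℝ (Fin d)) (EuclideanHalfSpace 1)) :=
  (𝓡 d).prod (𝓡∂ 1)

/-- A closed (compact, without boundary) smooth oriented `d`-manifold, possibly empty or
disconnected. -/
structure ClosedManifold (d : ℕ) where
  carrier : Type
  [top : TopologicalSpace carrier]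
  [t2 : T2Space carrier]
  [compact : CompactSpace carrier]
  [charted : ChartedSpace (EuclideanSpace ℝ (Fin d)) carrier]
  [smooth : IsManifold (𝓡 d) ∞ carrier]
  orientation : ∀ x : carrier, Orientation ℝ (TangentSpace (𝓡 d) x) (Fin d)
  orientation_cont : IsContinuousOrientation (𝓡 d) orientation

instance {d : ℕ} : CoeSort (ClosedManifold d) Type := ⟨ClosedManifold.carrier⟩

attribute [instance] ClosedManifold.top ClosedManifold.t2 ClosedManifold.compact
  ClosedManifold.charted ClosedManifold.smooth

/-- An oriented cobordism from `A` to `B`: a compact smooth oriented `(d + 1)`-manifold with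
boundary, together with embeddings of `A` and `B` whose images are disjoint and make up the boundary
(the in-boundary and the out-boundary). The embedding of `B` preserves orientations and that of `A`
reverses them, for the boundary orientation with the outward normal vector first; equivalently, one
uses an outward normal vector first along `B` and an inward one along `A`. A tangent vector at a
boundary point is inward (outward) if its last coordinate is positive (negative). The orientation
conditions make the derivatives of the two maps injective. -/
structure Cobordism {d : ℕ} (A B : ClosedManifold d) where
  carrier : Type
  [top : TopologicalSpace carrier]
  [t2 : T2Space carrier]
  [compact : CompactSpace carrier]
  [charted : ChartedSpace (ModelProd (EuclideanSpace ℝ (Fin d)) (EuclideanHalfSpace 1)) carrier]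
  [smooth : IsManifold (halfSpaceModel d) ∞ carrier]
  orientation : ∀ x : carrier, Orientation ℝ (TangentSpace (halfSpaceModel d) x) (Fin (d + 1))
  orientation_cont : IsContinuousOrientation (halfSpaceModel d) orientation
  inMap : A → carrier
  outMap : B → carrier
  inMap_smooth : ContMDiff (𝓡 d) (halfSpaceModel d) ∞ inMap
  outMap_smooth : ContMDiff (𝓡 d) (halfSpaceModel d) ∞ outMap
  inMap_injective : Function.Injective inMap
  outMap_injective : Function.Injective outMap
  disjoint_range : Disjoint (Set.range inMap) (Set.range outMap)
  range_union : Set.range inMap ∪ Set.range outMap = (halfSpaceModel d).boundary carrier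
  inMap_orientation : ∀ (a : A) (v : EuclideanSpace ℝ (Fin d) × EuclideanSpace ℝ (Fin 1)),
    0 < v.2 0 → InducesOrientation (mfderiv (𝓡 d) (halfSpaceModel d) inMap a).toLinearMap v
      (A.orientation a) (orientation (inMap a))
  outMap_orientation : ∀ (b : B) (v : EuclideanSpace ℝ (Fin d) × EuclideanSpace ℝ (Fin 1)),
    v.2 0 < 0 → InducesOrientation (mfderiv (𝓡 d) (halfSpaceModel d) outMap b).toLinearMap v
      (B.orientation b) (orientation (outMap b))

instance {d : ℕ} (A B : ClosedManifold d) : CoeSort (Cobordism A B) Type := ⟨Cobordism.carrier⟩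

attribute [instance] Cobordism.top Cobordism.t2 Cobordism.compact Cobordism.charted
  Cobordism.smooth

/-- The empty closed manifold. -/
def ClosedManifold.empty (d : ℕ) : ClosedManifold d :=
  letI : ChartedSpace (EuclideanSpace ℝ (Fin d)) Empty := ChartedSpace.empty _ _
  { carrier := Empty
    orientation := fun x => x.elim
    orientation_cont := fun x => x.elim }

section SumHelpers

variable {E : Type*} [NormedAddCommGroup E] [NormedSpace ℝ E] {H : Type*} [TopologicalSpace H]
  {M N : Type*} [TopologicalSpace M] [ChartedSpace H M] [TopologicalSpace N]
  [ChartedSpace H N] {I : ModelWithCorners ℝ E H}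

theorem extChartAt_sum_inl_symm (x : M) (p : E) :
    (extChartAt I (Sum.inl x : M ⊕ N)).symm p = Sum.inl ((extChartAt I x).symm p) := by
  simp [extChartAt, ChartedSpace.sum_chartAt_inl]

theorem extChartAt_sum_inr_symm (x : N) (p : E) :
    (extChartAt I (Sum.inr x : M ⊕ N)).symm p = Sum.inr ((extChartAt I x).symm p) := by
  simp [extChartAt, ChartedSpace.sum_chartAt_inr]

theorem tangentCoordChange_sum_inl [IsManifold I 1 M] [IsManifold I 1 N] (x y z : M) :
    tangentCoordChange I (Sum.inl y : M ⊕ N) (Sum.inl x) (Sum.inl z)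
      = tangentCoordChange I y x z := by
  rw [tangentCoordChange_def, tangentCoordChange_def, extChartAt_inl_apply]
  congr 1
  funext p
  simp only [Function.comp_apply, extChartAt_sum_inl_symm, extChartAt_inl_apply]

theorem tangentCoordChange_sum_inr [IsManifold I 1 M] [IsManifold I 1 N] (x y z : N) :
    tangentCoordChange I (Sum.inr y : M ⊕ N) (Sum.inr x) (Sum.inr z)
      = tangentCoordChange I y x z := by
  rw [tangentCoordChange_def, tangentCoordChange_def, extChartAt_inr_apply]
  congr 1
  funext p
  simp only [Function.comp_apply, extChartAt_sum_inr_symm, extChartAt_inr_apply]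

theorem IsContinuousOrientation.sum {ι : Type*} [IsManifold I ∞ M] [IsManifold I ∞ N]
    {o : ∀ x : M, Orientation ℝ (TangentSpace I x) ι}
    {o' : ∀ x : N, Orientation ℝ (TangentSpace I x) ι}
    (h : IsContinuousOrientation I o) (h' : IsContinuousOrientation I o') :
    IsContinuousOrientation I (sumOrientation I o o') := by
  rintro (x | x)
  · rw [(Topology.IsOpenEmbedding.inl (Y := N)).map_nhds_eq x |>.symm, Filter.eventually_map]
    filter_upwards [h x] with y hy
    rw [tangentCoordChange_sum_inl]
    exact hy
  · rw [(Topology.IsOpenEmbedding.inr (X := M)).map_nhds_eq x |>.symm, Filter.eventually_map]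
    filter_upwards [h' x] with y hy
    rw [tangentCoordChange_sum_inr]
    exact hy

variable {E' : Type*} [NormedAddCommGroup E'] [NormedSpace ℝ E'] {H' : Type*}
  [TopologicalSpace H'] {M' N' : Type*} [TopologicalSpace M'] [ChartedSpace H' M']
  [TopologicalSpace N'] [ChartedSpace H' N'] {J : ModelWithCorners ℝ E' H'}

theorem mfderiv_sumMap_inl {f : M → M'} {g : N → N'} (hf : ContMDiff I J ∞ f)
    (hg : ContMDiff I J ∞ g) (x : M) :
    (mfderiv I J (Sum.map f g) (Sum.inl x : M ⊕ N) : E →L[ℝ] E') = mfderiv I J f x := by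
  have h1 : MDifferentiableAt I J f x := (hf x).mdifferentiableAt (by simp)
  have h2 : MDifferentiableAt I J (Sum.map f g) (Sum.inl x : M ⊕ N) :=
    ((hf.sumMap hg) _).mdifferentiableAt (by simp)
  refine h2.mfderiv.trans (Eq.trans ?_ h1.mfderiv.symm)
  rw [extChartAt_inl_apply]
  congr 1
  funext p
  simp only [writtenInExtChartAt, Function.comp_apply, extChartAt_sum_inl_symm, Sum.map_inl,
    extChartAt_inl_apply]

theorem mfderiv_sumMap_inr {f : M → M'} {g : N → N'} (hf : ContMDiff I J ∞ f)
    (hg : ContMDiff I J ∞ g) (x : N) :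
    (mfderiv I J (Sum.map f g) (Sum.inr x : M ⊕ N) : E →L[ℝ] E') = mfderiv I J g x := by
  have h1 : MDifferentiableAt I J g x := (hg x).mdifferentiableAt (by simp)
  have h2 : MDifferentiableAt I J (Sum.map f g) (Sum.inr x : M ⊕ N) :=
    ((hf.sumMap hg) _).mdifferentiableAt (by simp)
  refine h2.mfderiv.trans (Eq.trans ?_ h1.mfderiv.symm)
  rw [extChartAt_inr_apply]
  congr 1
  funext p
  simp only [writtenInExtChartAt, Function.comp_apply, extChartAt_sum_inr_symm, Sum.map_inr,
    extChartAt_inr_apply]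

end SumHelpers

/-- The disjoint union of closed manifolds. -/
def ClosedManifold.sum {d : ℕ} (A B : ClosedManifold d) : ClosedManifold d where
  carrier := A ⊕ B
  orientation := sumOrientation (𝓡 d) A.orientation B.orientation
  orientation_cont := A.orientation_cont.sum B.orientation_cont

/-- The disjoint union of cobordisms. -/
def Cobordism.sum {d : ℕ} {A B A' B' : ClosedManifold d} (M : Cobordism A B)
    (N : Cobordism A' B') : Cobordism (A.sum A') (B.sum B') where
  carrier := M ⊕ N
  orientation := sumOrientation (halfSpaceModel d) M.orientation N.orientation
  orientation_cont := M.orientation_cont.sum N.orientation_cont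
  inMap := Sum.map M.inMap N.inMap
  outMap := Sum.map M.outMap N.outMap
  inMap_smooth := M.inMap_smooth.sumMap N.inMap_smooth
  outMap_smooth := M.outMap_smooth.sumMap N.outMap_smooth
  inMap_injective := M.inMap_injective.sumMap N.inMap_injective
  outMap_injective := M.outMap_injective.sumMap N.outMap_injective
  disjoint_range := by
    have hM := Set.disjoint_range_iff.1 M.disjoint_range
    have hN := Set.disjoint_range_iff.1 N.disjoint_range
    refine Set.disjoint_range_iff.2 ?_
    rintro (a | a) (b | b) h
    · exact hM a b (Sum.inl_injective h)
    · cases h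
    · cases h
    · exact hN a b (Sum.inr_injective h)
  range_union := by
    have key : ∀ {X Y X' Y' : Type} (f : X → X') (g : Y → Y'),
        Set.range (Sum.map f g) = Sum.inl '' Set.range f ∪ Sum.inr '' Set.range g := by
      intro X Y X' Y' f g
      ext x
      cases x <;> simp
    rw [ModelWithCorners.boundary_disjointUnion, ← M.range_union, ← N.range_union,
      Set.image_union, Set.image_union, Set.union_union_union_comm]
    exact congrArg₂ (· ∪ ·) (key M.inMap N.inMap) (key M.outMap N.outMap)
  inMap_orientation := by
    rintro (a | a) v hv
    · have h := M.inMap_orientation a v hv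
      rw [← mfderiv_sumMap_inl M.inMap_smooth N.inMap_smooth a] at h
      exact h
    · have h := N.inMap_orientation a v hv
      rw [← mfderiv_sumMap_inr M.inMap_smooth N.inMap_smooth a] at h
      exact h
  outMap_orientation := by
    rintro (a | a) v hv
    · have h := M.outMap_orientation a v hv
      rw [← mfderiv_sumMap_inl M.outMap_smooth N.outMap_smooth a] at h
      exact h
    · have h := N.outMap_orientation a v hv
      rw [← mfderiv_sumMap_inr M.outMap_smooth N.outMap_smooth a] at h
      exact h

/-- Two cobordisms from `A` to `B` are equivalent if there is an orientation-preserving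
diffeomorphism between them that commutes with the boundary embeddings. -/
def Cobordism.Equivalent {d : ℕ} {A B : ClosedManifold d} (M N : Cobordism A B) : Prop :=
  ∃ ψ : M ≃ₘ^∞⟮halfSpaceModel d, halfSpaceModel d⟯ N,
    (∀ x : M, PreservesOrientation
      (mfderiv (halfSpaceModel d) (halfSpaceModel d) ψ x).toLinearMap
      (M.orientation x) (N.orientation (ψ x))) ∧
    (∀ a : A, ψ (M.inMap a) = N.inMap a) ∧ (∀ b : B, ψ (M.outMap b) = N.outMap b)

/-- The cobordism `P` is obtained by gluing `M` and `N` along `B`: it is the union of two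
smoothly embedded, orientation-preserving copies of `M` and `N` that meet exactly along `B`. -/
def Cobordism.IsGluing {d : ℕ} {A B C : ClosedManifold d} (M : Cobordism A B)
    (N : Cobordism B C) (P : Cobordism A C) : Prop :=
  ∃ (i : M → P) (j : N → P),
    ContMDiff (halfSpaceModel d) (halfSpaceModel d) ∞ i ∧
    ContMDiff (halfSpaceModel d) (halfSpaceModel d) ∞ j ∧
    Function.Injective i ∧ Function.Injective j ∧
    (∀ x : M, PreservesOrientation
      (mfderiv (halfSpaceModel d) (halfSpaceModel d) i x).toLinearMap
      (M.orientation x) (P.orientation (i x))) ∧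
    (∀ y : N, PreservesOrientation
      (mfderiv (halfSpaceModel d) (halfSpaceModel d) j y).toLinearMap
      (N.orientation y) (P.orientation (j y))) ∧
    Set.range i ∪ Set.range j = Set.univ ∧
    (∀ (x : M) (y : N), i x = j y ↔ ∃ b : B, x = M.outMap b ∧ y = N.inMap b) ∧
    (∀ a : A, i (M.inMap a) = P.inMap a) ∧ (∀ c : C, j (N.outMap c) = P.outMap c)

/-- The cobordism `M` is the mapping cylinder of the diffeomorphism `f : A → B`: it is a copy of
`A × [0, 1]`, with in-boundary `a ↦ (a, 0)` and out-boundary `f a ↦ (a, 1)`. For `f = id` this is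
the cylinder on `A`. (The boundary conditions of a cobordism force `f` to be an
orientation-preserving diffeomorphism and the orientation of `M` to be the product orientation.) -/
def Cobordism.IsMappingCylinder {d : ℕ} {A B : ClosedManifold d} (M : Cobordism A B)
    (f : A ≃ B) : Prop :=
  ∃ φ : (A × Set.Icc (0 : ℝ) 1) ≃ₘ^∞⟮halfSpaceModel d, halfSpaceModel d⟯ M,
    (∀ a : A, φ (a, 0) = M.inMap a) ∧ (∀ a : A, φ (a, 1) = M.outMap (f a))

/-! ### Topological quantum field theories -/

section TQFT

/-- A `(d + 1)`-dimensional oriented TQFT over `k`, that is, a symmetric monoidal functor from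
`(d + 1)`-dimensional cobordisms to vector spaces: `V A` is the vector space of `A`, `Z M` is the
linear map of the cobordism `M`, and `ε` and `μ` are the identifications `k = V ∅` and
`V A ⊗ V B = V (A ⊔ B)`. -/
structure IsTQFT (k : Type*) [Field k] {d : ℕ} (V : ClosedManifold d → Type*)
    [∀ A, AddCommGroup (V A)] [∀ A, Module k (V A)]
    (ε : k ≃ₗ[k] V (ClosedManifold.empty d))
    (μ : ∀ A B : ClosedManifold d, V A ⊗[k] V B ≃ₗ[k] V (A.sum B))
    (Z : ∀ {A B : ClosedManifold d}, Cobordism A B → (V A →ₗ[k] V B)) : Prop where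
  /-- Equivalent cobordisms have the same image. -/
  map_equivalent : ∀ {A B : ClosedManifold d} (M N : Cobordism A B), M.Equivalent N → Z M = Z N
  /-- Gluing goes to composition. -/
  map_gluing : ∀ {A B C : ClosedManifold d} (M : Cobordism A B) (N : Cobordism B C)
    (P : Cobordism A C), M.IsGluing N P → Z P = Z N ∘ₗ Z M
  /-- Cylinders go to identity maps. -/
  map_cylinder : ∀ {A : ClosedManifold d} (M : Cobordism A A),
    M.IsMappingCylinder (Equiv.refl A) → Z M = LinearMap.id
  /-- Disjoint unions of cobordisms go to tensor products. -/
  map_sum : ∀ {A B A' B' : ClosedManifold d} (M : Cobordism A B) (N : Cobordism A' B'),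
    Z (M.sum N) ∘ₗ (μ A A').toLinearMap = (μ B B').toLinearMap ∘ₗ TensorProduct.map (Z M) (Z N)
  /-- Compatibility with the associativity of disjoint unions. -/
  map_assoc : ∀ {A B C : ClosedManifold d}
    (M : Cobordism ((A.sum B).sum C) (A.sum (B.sum C))),
    M.IsMappingCylinder (Equiv.sumAssoc A B C) → ∀ (x : V A) (y : V B) (z : V C),
      Z M (μ (A.sum B) C (μ A B (x ⊗ₜ y) ⊗ₜ z)) = μ A (B.sum C) (x ⊗ₜ μ B C (y ⊗ₜ z))
  /-- Compatibility with the unit on the left. -/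
  map_empty_sum : ∀ {A : ClosedManifold d} (M : Cobordism ((ClosedManifold.empty d).sum A) A),
    M.IsMappingCylinder (Equiv.emptySum Empty A) → ∀ (c : k) (x : V A),
      Z M (μ (ClosedManifold.empty d) A (ε c ⊗ₜ x)) = c • x
  /-- Compatibility with the unit on the right. -/
  map_sum_empty : ∀ {A : ClosedManifold d} (M : Cobordism (A.sum (ClosedManifold.empty d)) A),
    M.IsMappingCylinder (Equiv.sumEmpty A Empty) → ∀ (c : k) (x : V A),
      Z M (μ A (ClosedManifold.empty d) (x ⊗ₜ ε c)) = c • x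
  /-- Compatibility with the symmetry. -/
  map_symm : ∀ {A B : ClosedManifold d} (M : Cobordism (A.sum B) (B.sum A)),
    M.IsMappingCylinder (Equiv.sumComm A B) → ∀ (x : V A) (y : V B),
      Z M (μ A B (x ⊗ₜ y)) = μ B A (y ⊗ₜ x)

/-- A `(d + 1)`-dimensional oriented TQFT over `k` whose vector spaces are all equal to the ground
field `k`, with the canonical identification `k ⊗ k = k`. Two of them are equal if they assign the
same linear maps `k → k` to all cobordisms. -/
@[ext]
structure LineTQFT (k : Type*) [Field k] (d : ℕ) where
  map : ∀ {A B : ClosedManifold d}, Cobordism A B → (k →ₗ[k] k)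
  isTQFT : IsTQFT k (fun _ : ClosedManifold d => k) (LinearEquiv.refl k k)
    (fun _ _ => TensorProduct.lid k k) map

namespace LineTQFT

variable {k : Type*} [Field k] {d : ℕ}

theorem end_apply (f : k →ₗ[k] k) (x : k) : f x = x * f 1 := by
  rw [← smul_eq_mul, ← map_smul, smul_eq_mul, mul_one]

theorem end_comp_comm (f g : k →ₗ[k] k) : f ∘ₗ g = g ∘ₗ f := by
  ext
  simp only [LinearMap.comp_apply]
  rw [end_apply f, end_apply g (f 1), mul_comm]

/-- The trivial TQFT: every cobordism goes to the identity of `k`. -/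
def trivial (k : Type*) [Field k] (d : ℕ) : LineTQFT k d where
  map _ := LinearMap.id
  isTQFT :=
    { map_equivalent := fun _ _ _ => rfl
      map_gluing := fun _ _ _ _ => rfl
      map_cylinder := fun _ _ => rfl
      map_sum := fun _ _ => by simp
      map_assoc := fun _ _ x y z => by simp [mul_assoc]
      map_empty_sum := fun _ _ c x => by simp
      map_sum_empty := fun _ _ c x => by simp [mul_comm]
      map_symm := fun _ _ x y => by simp [mul_comm] }

/-- The tensor product `f ⊗ g : k ⊗ k → k ⊗ k`, where `k ⊗ k = k`. -/
def tensorEnd (f g : k →ₗ[k] k) : k →ₗ[k] k :=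
  (TensorProduct.lid k k).toLinearMap ∘ₗ TensorProduct.map f g ∘ₗ
    (TensorProduct.lid k k).symm.toLinearMap

theorem tensorEnd_eq_comp (f g : k →ₗ[k] k) : tensorEnd f g = f ∘ₗ g := by
  ext
  rw [LinearMap.comp_apply, end_apply f (g 1)]
  simp [tensorEnd, mul_comm]

/-- The product of TQFTs: the tensor product of vector spaces and linear maps. -/
def tensor (S T : LineTQFT k d) : LineTQFT k d where
  map M := tensorEnd (S.map M) (T.map M)
  isTQFT :=
    { map_equivalent := fun M N h => by
        rw [S.isTQFT.map_equivalent M N h, T.isTQFT.map_equivalent M N h]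
      map_gluing := fun M N P h => by
        simp only [tensorEnd_eq_comp]
        rw [S.isTQFT.map_gluing M N P h, T.isTQFT.map_gluing M N P h]
        simp only [LinearMap.comp_assoc]
        rw [← LinearMap.comp_assoc (T.map M), end_comp_comm (S.map M) (T.map N)]
        simp only [LinearMap.comp_assoc]
      map_cylinder := fun M h => by
        rw [tensorEnd_eq_comp, S.isTQFT.map_cylinder M h, T.isTQFT.map_cylinder M h]
        rfl
      map_sum := fun M N => by
        simp only [tensorEnd_eq_comp]
        rw [LinearMap.comp_assoc, T.isTQFT.map_sum M N, ← LinearMap.comp_assoc,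
          S.isTQFT.map_sum M N, LinearMap.comp_assoc, ← TensorProduct.map_comp]
      map_assoc := fun M h x y z => by
        have h1 := S.isTQFT.map_assoc M h x y z
        have h2 := T.isTQFT.map_assoc M h x y z
        rw [tensorEnd_eq_comp, LinearMap.comp_apply, h2]
        simpa [mul_assoc] using h1
      map_empty_sum := fun M h c x => by
        have h1 := S.isTQFT.map_empty_sum M h c x
        have h2 := T.isTQFT.map_empty_sum M h c x
        rw [tensorEnd_eq_comp, LinearMap.comp_apply, h2]
        simpa [mul_assoc, mul_comm] using h1
      map_sum_empty := fun M h c x => by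
        have h1 := S.isTQFT.map_sum_empty M h c x
        have h2 := T.isTQFT.map_sum_empty M h c x
        rw [tensorEnd_eq_comp, LinearMap.comp_apply, h2]
        simpa [mul_assoc, mul_comm] using h1
      map_symm := fun M h x y => by
        have h1 := S.isTQFT.map_symm M h x y
        have h2 := T.isTQFT.map_symm M h x y
        rw [tensorEnd_eq_comp, LinearMap.comp_apply, h2]
        simpa [mul_assoc, mul_comm] using h1 }

instance : CommMonoid (LineTQFT k d) where
  mul := tensor
  one := trivial k d
  mul_assoc R S T := by
    refine LineTQFT.ext ?_
    funext A B M
    change tensorEnd (tensorEnd _ _) _ = tensorEnd _ (tensorEnd _ _)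
    simp only [tensorEnd_eq_comp, LinearMap.comp_assoc]
  one_mul T := by
    refine LineTQFT.ext ?_
    funext A B M
    exact tensorEnd_eq_comp _ _
  mul_one T := by
    refine LineTQFT.ext ?_
    funext A B M
    exact tensorEnd_eq_comp _ _
  mul_comm S T := by
    refine LineTQFT.ext ?_
    funext A B M
    change tensorEnd _ _ = tensorEnd _ _
    rw [tensorEnd_eq_comp, tensorEnd_eq_comp, end_comp_comm]

theorem mul_map (S T : LineTQFT k d) {A B : ClosedManifold d} (M : Cobordism A B) :
    (S * T).map M = S.map M ∘ₗ T.map M :=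
  tensorEnd_eq_comp _ _

theorem one_map {A B : ClosedManifold d} (M : Cobordism A B) :
    (1 : LineTQFT k d).map M = LinearMap.id := rfl

end LineTQFT

/-- The group of invertible TQFTs: those `T` for which there is a `T'` such that `T ⊗ T'` is the
trivial TQFT. -/
abbrev InvertibleTQFT (k : Type*) [Field k] (d : ℕ) : Type _ := (LineTQFT k d)ˣ

/-- The subgroup of the invertible TQFTs that send every cobordism with empty boundary to the
identity of `k`. -/
def trivialOnClosed (k : Type*) [Field k] (d : ℕ) : Subgroup (InvertibleTQFT k d) where
  carrier := {T | ∀ (A B : ClosedManifold d) (M : Cobordism A B),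
    (halfSpaceModel d).boundary M = ∅ → (T : LineTQFT k d).map M = LinearMap.id}
  one_mem' := fun _ _ _ _ => rfl
  mul_mem' := fun {S T} hS hT A B M hM => by
    rw [Units.val_mul, LineTQFT.mul_map, hS A B M hM, hT A B M hM]
    rfl
  inv_mem' := fun {T} hT A B M hM => by
    have h := LineTQFT.mul_map (T : LineTQFT k d) ((T⁻¹ : InvertibleTQFT k d) : LineTQFT k d) M
    rw [Units.mul_inv, LineTQFT.one_map, hT A B M hM] at h
    exact h.symm

end TQFT

end

/-!
A multiplicative invariant `f` of closed `d`-manifolds with values in `kˣ` defines an invertible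
TQFT `M ↦ f B / f A`, for `M : A ⇝ B`. It is the identity on every cobordism with empty boundary,
while the disc `∅ ⇝ S^d` goes to multiplication by `f S^d`. Every unit `u` occurs as `f S^d`: for
`1 ≤ d` take `u` to the number of connected components; the sphere `S^0` has two components but
exactly one positive point, so for `d = 0` take `u` to the number of positive points. Hence `u = 1`
if these TQFTs are all trivial. Conversely, an invertible TQFT takes its values in `kˣ`.
-/

noncomputable section

section MultiplicativeInvariants

variable {k : Type*} [Field k] {d : ℕ} {A B : ClosedManifold d}

instance (d : ℕ) : IsEmpty (ClosedManifold.empty d) := inferInstanceAs (IsEmpty Empty)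

/-- A multiplicative invariant of closed manifolds: a function to a commutative monoid that turns
disjoint unions into products and is `1` on all empty manifolds, for any of their (formally
different) empty carriers. -/
structure MultiplicativeInvariant (d : ℕ) (G : Type*) [CommMonoid G] where
  toFun : ClosedManifold d → G
  map_of_isEmpty : ∀ (A : ClosedManifold d) [IsEmpty A], toFun A = 1
  map_sum : ∀ A B : ClosedManifold d, toFun (A.sum B) = toFun A * toFun B

namespace MultiplicativeInvariant

instance (G : Type*) [CommMonoid G] :
    CoeFun (MultiplicativeInvariant d G) fun _ => ClosedManifold d → G := ⟨toFun⟩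

instance (G : Type*) [CommGroup G] : Inv (MultiplicativeInvariant d G) where
  inv f :=
    { toFun := fun A => (f A)⁻¹
      map_of_isEmpty := fun A _ => by rw [f.map_of_isEmpty A, inv_one]
      map_sum := fun A B => by rw [f.map_sum, mul_inv] }

end MultiplicativeInvariant

namespace LineTQFT

/-- The scalar by which a TQFT acts on the cobordism `M`. -/
def value (M : Cobordism A B) : LineTQFT k d →* k where
  toFun T := T.map M 1
  map_one' := rfl
  map_mul' S T := by rw [mul_map, LinearMap.comp_apply, end_apply, mul_comm]

theorem map_eq_id_iff_value_eq_one {T : LineTQFT k d} {M : Cobordism A B} :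
    T.map M = LinearMap.id ↔ value M T = 1 :=
  ⟨fun h => LinearMap.congr_fun h 1, fun h => LinearMap.ext_ring h⟩

theorem ext_value {S T : LineTQFT k d}
    (h : ∀ (A B : ClosedManifold d) (M : Cobordism A B), value M S = value M T) : S = T :=
  LineTQFT.ext <| funext fun A => funext fun B => funext fun M => LinearMap.ext_ring (h A B M)

/-- The TQFT `M ↦ f B / f A`, for `M : A ⇝ B`, of a multiplicative invariant `f`. -/
def ofInvariant (f : MultiplicativeInvariant d kˣ) : LineTQFT k d where
  map {A B} _ := ((f B / f A : kˣ) : k) • LinearMap.id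
  isTQFT :=
    { map_equivalent := fun _ _ _ => rfl
      map_gluing := fun {A B C} _ _ _ _ => by
        ext
        simp only [LinearMap.smul_apply, LinearMap.comp_apply, LinearMap.id_apply, smul_smul,
          ← Units.val_mul, div_mul_div_cancel]
      map_cylinder := fun _ _ => by simp
      map_sum := fun {A B A' B'} _ _ => by
        ext
        simp [f.map_sum, mul_div_mul_comm]
      map_assoc := fun _ _ x y z => by simp [f.map_sum, mul_assoc]
      map_empty_sum := fun _ _ c x => by simp [f.map_sum, f.map_of_isEmpty]
      map_sum_empty := fun _ _ c x => by simp [f.map_sum, f.map_of_isEmpty, mul_comm]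
      map_symm := fun {A B} _ _ x y => by simp [f.map_sum, mul_comm] }

theorem value_ofInvariant (f : MultiplicativeInvariant d kˣ) (M : Cobordism A B) :
    value M (ofInvariant f) = ((f B / f A : kˣ) : k) :=
  mul_one _

theorem ofInvariant_mul_ofInvariant_inv (f : MultiplicativeInvariant d kˣ) :
    ofInvariant f * ofInvariant f⁻¹ = 1 := by
  refine ext_value fun A B M => ?_
  rw [map_mul, map_one, value_ofInvariant, value_ofInvariant, ← Units.val_mul]
  change ((f B / f A * ((f B)⁻¹ / (f A)⁻¹) : kˣ) : k) = 1
  rw [inv_div_inv, div_mul_div_cancel, div_self', Units.val_one]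

end LineTQFT

namespace InvertibleTQFT

open LineTQFT

/-- The TQFT of a multiplicative invariant as an invertible TQFT. -/
def ofInvariant (f : MultiplicativeInvariant d kˣ) : InvertibleTQFT k d :=
  Units.mkOfMulEqOne _ _ (ofInvariant_mul_ofInvariant_inv f)

theorem ofInvariant_mem_trivialOnClosed (f : MultiplicativeInvariant d kˣ) :
    ofInvariant f ∈ trivialOnClosed k d := by
  intro A B M hM
  obtain ⟨hA, hB⟩ : IsEmpty A ∧ IsEmpty B := by
    simpa only [hM, Set.union_empty_iff, Set.range_eq_empty_iff] using M.range_union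
  refine map_eq_id_iff_value_eq_one.2 ((value_ofInvariant f M).trans ?_)
  rw [f.map_of_isEmpty A, f.map_of_isEmpty B, div_self', Units.val_one]

theorem eq_of_trivialOnClosed_eq_bot (h : trivialOnClosed k d = ⊥)
    (f : MultiplicativeInvariant d kˣ) (M : Cobordism A B) : f A = f B := by
  have hf : ofInvariant f = 1 :=
    Subgroup.mem_bot.1 (h ▸ ofInvariant_mem_trivialOnClosed f)
  have hM : ((f B / f A : kˣ) : k) = 1 :=
    (value_ofInvariant f M).symm.trans (congrArg (Units.map (value M)) hf |> congrArg Units.val)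
  exact (div_eq_one.1 (Units.val_eq_one.1 hM)).symm

instance [Subsingleton kˣ] : Subsingleton (InvertibleTQFT k d) where
  allEq S T := Units.ext <| ext_value fun _ _ M =>
    congrArg Units.val (Subsingleton.elim (Units.map (value M) S) (Units.map (value M) T))

end InvertibleTQFT

end MultiplicativeInvariants

section Invariants

/-- The connected components of a disjoint union. -/
def connectedComponentsSum (X Y : Type*) [TopologicalSpace X] [TopologicalSpace Y] :
    ConnectedComponents (X ⊕ Y) ≃ ConnectedComponents X ⊕ ConnectedComponents Y where
  toFun := (continuous_sumMap.2 ⟨ConnectedComponents.continuous_coe,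
    ConnectedComponents.continuous_coe⟩).connectedComponentsLift
  invFun := Sum.elim continuous_inl.connectedComponentsMap continuous_inr.connectedComponentsMap
  left_inv x := by
    obtain ⟨x | x, rfl⟩ := ConnectedComponents.surjective_coe x <;> rfl
  right_inv x := by
    rcases x with x | x <;> obtain ⟨x, rfl⟩ := ConnectedComponents.surjective_coe x <;> rfl

theorem rayOfNeZero_eq_positiveOrientation_iff {ι E : Type*} [IsEmpty ι] [AddCommGroup E]
    [Module ℝ E] {η : E [⋀^ι]→ₗ[ℝ] ℝ} (hη : η ≠ 0) :
    rayOfNeZero ℝ η hη = Module.Oriented.positiveOrientation ↔ 0 < η 0 := by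
  let one : E [⋀^ι]→ₗ[ℝ] ℝ := AlternatingMap.constLinearEquivOfIsEmpty 1
  have hη_eq : η = η 0 • one := by
    ext u
    rw [Subsingleton.elim u 0]
    exact (mul_one _).symm
  have h_one : one ≠ 0 := (LinearEquiv.map_ne_zero_iff _).2 one_ne_zero
  have hη0 : η 0 ≠ 0 := fun h => hη (by rw [hη_eq, h, zero_smul])
  refine (ray_eq_iff _ _).trans ?_
  conv_lhs => rw [hη_eq]
  exact sameRay_smul_left_iff_of_ne h_one hη0

namespace ClosedManifold

instance {d : ℕ} (A : ClosedManifold d) : Finite (ConnectedComponents A) :=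
  have : LocallyConnectedSpace A :=
    ChartedSpace.locallyConnectedSpace (EuclideanSpace ℝ (Fin d)) A
  inferInstance

instance (A : ClosedManifold 0) : Finite A :=
  have : DiscreteTopology A := ChartedSpace.discreteTopology (EuclideanSpace ℝ (Fin 0)) A
  finite_of_compact_of_discrete

/-- The positive points of an oriented `0`-manifold: those whose orientation is the sign `+`. -/
def IsPositive (A : ClosedManifold 0) (x : A) : Prop :=
  A.orientation x = (Module.Oriented.positiveOrientation :
    Orientation ℝ (EuclideanSpace ℝ (Fin 0)) (Fin 0))

end ClosedManifold

namespace MultiplicativeInvariant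

variable {G : Type*} [CommMonoid G]

/-- The invariant that takes the value `u` on each nonempty connected manifold. -/
def powCardComponents (d : ℕ) (u : G) : MultiplicativeInvariant d G where
  toFun A := u ^ Nat.card (ConnectedComponents A)
  map_of_isEmpty A _ := by
    have : IsEmpty (ConnectedComponents A) := ConnectedComponents.surjective_coe.isEmpty
    rw [Nat.card_of_isEmpty, pow_zero]
  map_sum A B := by
    rw [← pow_add]
    exact congrArg (u ^ ·) ((Nat.card_congr (connectedComponentsSum A B)).trans Nat.card_sum)

/-- The invariant of `0`-manifolds that takes the value `u` on each positive point and `1` on each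
negative point. -/
def powCardPositive (u : G) : MultiplicativeInvariant 0 G where
  toFun A := u ^ Nat.card {x // A.IsPositive x}
  map_of_isEmpty A _ := by rw [Nat.card_of_isEmpty, pow_zero]
  map_sum A B := by
    rw [← pow_add]
    exact congrArg (u ^ ·) ((Nat.card_congr (Equiv.subtypeSum (p := (A.sum B).IsPositive))).trans
      Nat.card_sum)

end MultiplicativeInvariant

end Invariants

section AlternatingForms

theorem sameRay_of_apply_basis_mul_pos {R ι F : Type*} [CommRing R] [LinearOrder R]
    [IsStrictOrderedRing R] [Finite ι] [AddCommGroup F] [Module R F] (b : Module.Basis ι R F)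
    {f g : F [⋀^ι]→ₗ[R] R} (h : 0 < f b * g b) : SameRay R f g := by
  classical
  have := Fintype.ofFinite ι
  rw [f.eq_smul_basis_det b, g.eq_smul_basis_det b]
  rcases pos_and_pos_or_neg_and_neg_of_mul_pos h with ⟨hf, hg⟩ | ⟨hf, hg⟩
  · exact ((SameRay.refl b.det).pos_smul_left hf).pos_smul_right hg
  · rw [← neg_smul_neg _ b.det, ← neg_smul_neg _ b.det]
    exact ((SameRay.refl (-b.det)).pos_smul_left (neg_pos.2 hf)).pos_smul_right (neg_pos.2 hg)

section Field

variable {K F W : Type*} [Field K] [AddCommGroup F] [Module K F] [AddCommGroup W] [Module K W]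
  {d : ℕ}

theorem curryLeft_compLinearMap_ne_zero {η : W [⋀^Fin (d + 1)]→ₗ[K] K} (hη : η ≠ 0)
    (hF : Module.finrank K F = d) (hW : Module.finrank K W = d + 1) {D : F →ₗ[K] W}
    (hD : Function.Injective D) {x : W} (hx : x ∉ D.range) :
    (η.curryLeft x).compLinearMap D ≠ 0 := by
  intro h
  have : Module.Finite K W := Module.finite_of_finrank_eq_succ hW
  have : Module.Finite K F := Module.Finite.of_injective D hD
  let b := Module.finBasisOfFinrankEq K F hF
  have hspan : Submodule.span K (Set.range (D ∘ b)) = D.range := by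
    rw [Set.range_comp, Submodule.span_image, b.span_eq, Submodule.map_top]
  have hli : LinearIndependent K (Fin.cons x (D ∘ b) : Fin (d + 1) → W) :=
    linearIndependent_finCons.2
      ⟨b.linearIndependent.map' D (LinearMap.ker_eq_bot.2 hD), hspan ▸ hx⟩
  let B := basisOfLinearIndependentOfCardEqFinrank hli (by rw [Fintype.card_fin, hW])
  refine (AlternatingMap.map_basis_ne_zero_iff B η).2 hη ?_
  rw [coe_basisOfLinearIndependentOfCardEqFinrank]
  exact DFunLike.congr_fun h ⇑b

variable [FiniteDimensional K F]

theorem alternatingMap_eq_zero_of_finrank_lt (hF : Module.finrank K F < d)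
    (η : F [⋀^Fin d]→ₗ[K] K) : η = 0 := by
  ext u
  refine η.map_linearDependent u fun hu => hF.not_ge ?_
  simpa only [Fintype.card_fin] using hu.fintype_card_le_finrank

theorem curryLeft_compLinearMap_eq_smul (hF : Module.finrank K F < d + 1)
    (η : W [⋀^Fin (d + 1)]→ₗ[K] K) {D : F →ₗ[K] W} {w x : W} {c : K}
    (hw : w - c • x ∈ D.range) :
    (η.curryLeft w).compLinearMap D = c • (η.curryLeft x).compLinearMap D := by
  obtain ⟨u, hu⟩ := hw
  have hzero : (η.curryLeft (D u)).compLinearMap D = 0 := by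
    rw [← AlternatingMap.curryLeft_compLinearMap,
      alternatingMap_eq_zero_of_finrank_lt hF (η.compLinearMap D)]
    rfl
  rw [hu, map_sub, map_smul] at hzero
  exact sub_eq_zero.1 hzero

end Field

theorem inducesOrientation_rayOfNeZero {E F W : Type*} [AddCommGroup E] [Module ℝ E]
    [AddCommGroup F] [Module ℝ F] [FiniteDimensional ℝ F] [AddCommGroup W] [Module ℝ W] {d : ℕ}
    (hF : Module.finrank ℝ F < d + 1) {η : W [⋀^Fin (d + 1)]→ₗ[ℝ] ℝ} {D : E →ₗ[ℝ] W}
    {L : F →ₗ[ℝ] E} {S : F →ₗ[ℝ] W} {x : W} {v : E} {c : ℝ} (hc : 0 < c) (hS : D ∘ₗ L = S)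
    (hv : D v - c • x ∈ S.range) (hη : η.compLinearMap D ≠ 0)
    (hx : (η.curryLeft x).compLinearMap S ≠ 0) :
    InducesOrientation L v (rayOfNeZero ℝ _ hx) (rayOfNeZero ℝ _ hη) := by
  have hcurry : ((η.compLinearMap D).curryLeft v).compLinearMap L =
      c • (η.curryLeft x).compLinearMap S := by
    rw [AlternatingMap.curryLeft_compLinearMap, AlternatingMap.compLinearMap_assoc, hS]
    exact curryLeft_compLinearMap_eq_smul hF η hv
  refine ⟨_, hη, hcurry ▸ smul_ne_zero hc.ne' hx, rfl, (ray_eq_iff _ _).2 ?_⟩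
  rw [hcurry]
  exact SameRay.sameRay_pos_smul_right _ hc

end AlternatingForms

section ContinuousOrientations

theorem preservesOrientation_rayOfNeZero {ι E E' : Type*} [Finite ι] [AddCommGroup E] [Module ℝ E]
    [AddCommGroup E'] [Module ℝ E'] {e : E ≃ₗ[ℝ] E'} (b : Module.Basis ι ℝ E')
    {f : E [⋀^ι]→ₗ[ℝ] ℝ} {g : E' [⋀^ι]→ₗ[ℝ] ℝ} (hf : f ≠ 0) (hg : g ≠ 0)
    (h : 0 < f (e.symm ∘ b) * g b) :
    PreservesOrientation e.toLinearMap (rayOfNeZero ℝ f hf) (rayOfNeZero ℝ g hg) :=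
  ⟨e, rfl, (ray_eq_iff _ _).2 (sameRay_of_apply_basis_mul_pos b h)⟩

theorem continuous_basis_det {ι W : Type*} [Fintype ι] [DecidableEq ι] [NormedAddCommGroup W]
    [NormedSpace ℝ W] (b : Module.Basis ι ℝ W) : Continuous b.det := by
  have : FiniteDimensional ℝ W := b.finiteDimensional_of_finite
  change Continuous fun v => (b.toMatrix v).det
  refine Continuous.matrix_det (continuous_matrix fun i j => ?_)
  exact (LinearMap.continuous_of_finiteDimensional (b.coord i)).comp (continuous_apply j)

variable {ι : Type*} [Finite ι] {F : Type*} [NormedAddCommGroup F] [NormedSpace ℝ F] {H : Type*}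
  [TopologicalSpace H] {I : ModelWithCorners ℝ F H} {M : Type*} [TopologicalSpace M]
  [ChartedSpace H M]

/-- The coordinate change between the charts at `x` and `y` as an isomorphism of tangent spaces. -/
def tangentCoordChangeEquiv [IsManifold I 1 M] {x y z : M}
    (hx : z ∈ (extChartAt I x).source) (hy : z ∈ (extChartAt I y).source) : F ≃ₗ[ℝ] F where
  toLinearMap := (tangentCoordChange I x y z : F →L[ℝ] F).toLinearMap
  invFun := tangentCoordChange I y x z
  left_inv _ := (tangentCoordChange_comp ⟨⟨hx, hy⟩, hx⟩).trans (tangentCoordChange_self hx)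
  right_inv _ := (tangentCoordChange_comp ⟨⟨hy, hx⟩, hy⟩).trans (tangentCoordChange_self hy)

theorem isContinuousOrientation_rayOfNeZero [IsManifold I ∞ M] (b : Module.Basis ι ℝ F)
    {θ : ∀ x : M, TangentSpace I x [⋀^ι]→ₗ[ℝ] ℝ} (hθ : ∀ x, θ x ≠ 0)
    (h : ∀ x, ContinuousAt (fun y => θ y (tangentCoordChange I x y y ∘ b)) x) :
    IsContinuousOrientation I fun x => rayOfNeZero ℝ (θ x) (hθ x) := by
  intro x
  have hself : θ x (tangentCoordChange I x x x ∘ b) = θ x b :=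
    congrArg (θ x) (funext fun j =>
      tangentCoordChange_self (v := b j) (mem_extChartAt_source (I := I) x))
  have hx : 0 < θ x (tangentCoordChange I x x x ∘ b) * θ x b := by
    rw [hself]
    exact mul_self_pos.2 ((AlternatingMap.map_basis_ne_zero_iff b (θ x)).2 (hθ x))
  filter_upwards [((h x).mul continuousAt_const).eventually (lt_mem_nhds hx),
    extChartAt_source_mem_nhds (I := I) x] with y hy hyx
  exact preservesOrientation_rayOfNeZero
    (e := tangentCoordChangeEquiv (mem_extChartAt_source y) hyx) b (hθ y) (hθ x) hy

theorem isContinuousOrientation_compLinearMap_mfderiv [IsManifold I ∞ M] {W : Type*}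
    [NormedAddCommGroup W] [NormedSpace ℝ W] (b : Module.Basis ι ℝ F) {i : M → W}
    (hi : ContMDiff I 𝓘(ℝ, W) ∞ i) {η : M → W [⋀^ι]→ₗ[ℝ] ℝ}
    (hη : Continuous fun p : M × (ι → W) => η p.1 p.2)
    (hne : ∀ x, (η x).compLinearMap (mfderiv I 𝓘(ℝ, W) i x).toLinearMap ≠ 0) :
    IsContinuousOrientation I fun x => rayOfNeZero ℝ _ (hne x) := by
  refine isContinuousOrientation_rayOfNeZero b hne fun x => ?_
  let D : M → F →L[ℝ] W := fun y => mfderiv I 𝓘(ℝ, W) i y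
  let D' : M → F →L[ℝ] W := inTangentCoordinates I 𝓘(ℝ, W) id i D x
  have hD' : ContinuousAt D' x := ((hi x).mfderiv_const (m := 0) (by simp)).continuousAt
  have hD'_eq : ∀ y ∈ (chartAt H x).source, D' y = D y ∘L tangentCoordChange I x y y := by
    intro y hy
    refine (inTangentCoordinates_eq id i D hy (mem_chart_source W (i y))).trans ?_
    ext v
    simp
  have hcont : ContinuousAt (fun y => η y fun j => D' y (b j)) x :=
    hη.continuousAt.comp (f := fun y => (y, fun j => D' y (b j)))
      (continuousAt_id.prodMk (continuousAt_pi.2 fun j => hD'.clm_apply continuousAt_const))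
  refine hcont.congr ?_
  filter_upwards [chart_source_mem_nhds H x] with y hy
  rw [hD'_eq y hy]
  rfl

end ContinuousOrientations

section AmbientAtlases

theorem coe_invFun_val {α : Type*} {S : Set α} [Nonempty S] {y : α} (hy : y ∈ S) :
    ((Function.invFun Subtype.val y : S) : α) = y :=
  Function.invFun_eq ⟨⟨y, hy⟩, rfl⟩

variable {E : Type*} [NormedAddCommGroup E] [NormedSpace ℝ E] {F : Type*} [NormedAddCommGroup F]
  [NormedSpace ℝ F] {H : Type*} [TopologicalSpace H]

/-- A chart of a subset `S` of a normed space, with values in the model space `F` of a manifold with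
boundary, that is smooth in both directions in the sense of the ambient spaces `E` and `F`. -/
structure AmbientChart (I : ModelWithCorners ℝ F H) (S : Set E) extends PartialEquiv E F where
  source_subset : source ⊆ S
  target_subset : target ⊆ Set.range I
  isOpen_source : IsOpen (((↑) : S → E) ⁻¹' source)
  isOpen_target : IsOpen (I ⁻¹' target)
  contDiffAt : ∀ x ∈ source, ContDiffAt ℝ ∞ toFun x
  contDiffAt_symm : ∀ y ∈ target, ContDiffAt ℝ ∞ invFun y

/-- A family of ambient charts of `S`, one around each point of `S`. -/
structure AmbientAtlas (I : ModelWithCorners ℝ F H) (S : Set E) where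
  chart : S → AmbientChart I S
  mem_source : ∀ x : S, (x : E) ∈ (chart x).source

variable {I : ModelWithCorners ℝ F H} {S : Set E}

namespace AmbientChart

variable (c : AmbientChart I S)

theorem target_mem_nhdsWithin {y : F} (hy : y ∈ c.target) : c.target ∈ 𝓝[Set.range I] y := by
  obtain ⟨h, rfl⟩ := c.target_subset hy
  rw [← I.map_nhds_eq]
  exact Filter.mem_map.2 (c.isOpen_target.mem_nhds hy)

theorem fderiv_comp_fderiv_symm {x : E} (hx : x ∈ c.source) :
    fderiv ℝ c.toPartialEquiv x ∘L fderiv ℝ c.symm (c.toPartialEquiv x) =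
      ContinuousLinearMap.id ℝ F := by
  have hy := c.map_source hx
  have hsymm : HasFDerivAt c.symm (fderiv ℝ c.symm (c.toPartialEquiv x)) (c.toPartialEquiv x) :=
    ((c.contDiffAt_symm _ hy).differentiableAt (by simp)).hasFDerivAt
  have hc : HasFDerivAt c.toPartialEquiv _ x :=
    ((c.contDiffAt x hx).differentiableAt (by simp)).hasFDerivAt
  rw [← c.left_inv hx] at hc
  have hid : HasFDerivWithinAt (c.toPartialEquiv ∘ c.symm) (ContinuousLinearMap.id ℝ F)
      (Set.range I) (c.toPartialEquiv x) :=
    (hasFDerivWithinAt_id _ _).congr_of_eventuallyEq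
      (Filter.mem_of_superset (c.target_mem_nhdsWithin hy) fun _ => c.right_inv) (c.right_inv hy)
  rw [← (I.uniqueDiffOn _ (c.target_subset hy)).eq (hc.comp _ hsymm).hasFDerivWithinAt hid,
    c.left_inv hx]

/-- The chart of the manifold `S`. -/
def toChart [Nonempty S] : OpenPartialHomeomorph S H where
  toFun x := I.symm (c.toPartialEquiv x)
  invFun y := Function.invFun Subtype.val (c.symm (I y))
  source := Subtype.val ⁻¹' c.source
  target := I ⁻¹' c.target
  map_source' x hx := by
    have hcx := c.map_source hx
    rwa [Set.mem_preimage, I.right_inv (c.target_subset hcx)]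
  map_target' y hy := by
    have hcy := c.map_target hy
    rwa [Set.mem_preimage, coe_invFun_val (c.source_subset hcy)]
  left_inv' x hx := by
    rw [I.right_inv (c.target_subset (c.map_source hx)), c.left_inv hx,
      Function.leftInverse_invFun Subtype.val_injective]
  right_inv' y hy := by
    rw [coe_invFun_val (c.source_subset (c.map_target hy)), c.right_inv hy, I.left_inv]
  open_source := c.isOpen_source
  open_target := c.isOpen_target
  continuousOn_toFun := I.continuous_symm.comp_continuousOn fun x hx =>
    ((c.contDiffAt x hx).continuousAt.comp continuous_subtype_val.continuousAt).continuousWithinAt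
  continuousOn_invFun := by
    refine Topology.IsInducing.subtypeVal.continuousOn_iff.2 (ContinuousOn.congr (fun y hy => ?_)
      fun y hy => coe_invFun_val (c.source_subset (c.map_target hy)))
    exact ((c.contDiffAt_symm _ hy).continuousAt.comp I.continuous.continuousAt).continuousWithinAt

variable [Nonempty S]

theorem coe_toChart {x : S} (hx : (x : E) ∈ c.source) : I (c.toChart x) = c.toPartialEquiv x :=
  I.right_inv (c.target_subset (c.map_source hx))

theorem coe_toChart_symm {y : F} (hy : y ∈ c.target) :
    (c.toChart.symm (I.symm y) : E) = c.symm y := by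
  change ((Function.invFun Subtype.val (c.symm (I (I.symm y))) : S) : E) = c.symm y
  rw [I.right_inv (c.target_subset hy), coe_invFun_val (c.source_subset (c.map_target hy))]

end AmbientChart

namespace AmbientAtlas

/-- The manifold defined by an ambient atlas: the set `S` with the charted space structure of the
atlas. -/
def Carrier (_ : AmbientAtlas I S) : Type _ := S

variable (a : AmbientAtlas I S)

instance : TopologicalSpace a.Carrier := instTopologicalSpaceSubtype

instance : CoeOut a.Carrier E := ⟨Subtype.val⟩

variable [Nonempty S]

instance : ChartedSpace H a.Carrier where
  atlas := Set.range fun x => (a.chart x).toChart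
  chartAt x := (a.chart x).toChart
  mem_chart_source x := a.mem_source x
  chart_mem_atlas x := ⟨x, rfl⟩

instance : IsManifold I ∞ a.Carrier := by
  refine isManifold_of_contDiffOn I ∞ _ ?_
  rintro _ _ ⟨x, rfl⟩ ⟨x', rfl⟩
  set c := a.chart x
  set c' := a.chart x'
  have hmem : ∀ y ∈ I.symm ⁻¹' (c.toChart.symm ≫ₕ c'.toChart).source ∩ Set.range I,
      y ∈ c.target ∧ c.symm y ∈ c'.source := by
    rintro _ ⟨hy, y, rfl⟩
    rw [Set.mem_preimage, OpenPartialHomeomorph.trans_source, I.left_inv] at hy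
    have hyc : I y ∈ c.target := hy.1
    rw [← c.coe_toChart_symm hyc, I.left_inv]
    exact ⟨hyc, hy.2⟩
  refine ContDiffOn.congr (f := c'.toPartialEquiv ∘ c.symm) (fun y hy => ?_) fun y hy => ?_
  · obtain ⟨hyc, hyc'⟩ := hmem y hy
    exact ((c'.contDiffAt _ hyc').comp y (c.contDiffAt_symm y hyc)).contDiffWithinAt
  · obtain ⟨hyc, hyc'⟩ := hmem y hy
    rw [← c.coe_toChart_symm hyc] at hyc'
    exact (c'.coe_toChart hyc').trans (congrArg c'.toPartialEquiv (c.coe_toChart_symm hyc))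

variable {a}

theorem extChartAt_apply {x z : a.Carrier} (hz : (z : E) ∈ (a.chart x).source) :
    extChartAt I x z = (a.chart x).toPartialEquiv z :=
  (a.chart x).coe_toChart hz

theorem coe_extChartAt_symm {x : a.Carrier} {y : F} (hy : y ∈ (a.chart x).target) :
    ((extChartAt I x).symm y : E) = (a.chart x).symm y :=
  (a.chart x).coe_toChart_symm hy

theorem coe_comp_extChartAt_symm_eventuallyEq (x : a.Carrier) :
    (fun y => ((extChartAt I x).symm y : E)) =ᶠ[𝓝[Set.range I] (extChartAt I x x)]
      (a.chart x).symm := by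
  rw [extChartAt_apply (a.mem_source x)]
  filter_upwards [(a.chart x).target_mem_nhdsWithin ((a.chart x).map_source (a.mem_source x))]
    with y hy using coe_extChartAt_symm hy

theorem contMDiff_coe : ContMDiff I 𝓘(ℝ, E) ∞ fun x : a.Carrier => (x : E) := by
  intro x
  refine contMDiffAt_iff.2 ⟨continuous_subtype_val.continuousAt, ?_⟩
  have hx := (a.chart x).map_source (a.mem_source x)
  rw [← extChartAt_apply (a.mem_source x)] at hx
  exact ((a.chart x).contDiffAt_symm _ hx).contDiffWithinAt.congr_of_eventuallyEq
    (coe_comp_extChartAt_symm_eventuallyEq x) (coe_extChartAt_symm hx)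

theorem mfderiv_coe (x : a.Carrier) :
    (mfderiv I 𝓘(ℝ, E) (fun x : a.Carrier => (x : E)) x : F →L[ℝ] E) =
      fderiv ℝ (a.chart x).symm ((a.chart x).toPartialEquiv x) := by
  have hx := (a.chart x).map_source (a.mem_source x)
  let D : F →L[ℝ] E := mfderiv I 𝓘(ℝ, E) (fun x : a.Carrier => (x : E)) x
  have hcoe : HasFDerivWithinAt (fun y => ((extChartAt I x).symm y : E)) D (Set.range I)
      (extChartAt I x x) :=
    (contMDiff_coe.mdifferentiableAt (by simp)).hasMFDerivAt.2
  have hsymm := (((a.chart x).contDiffAt_symm _ hx).differentiableAt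
    (by simp)).hasFDerivAt.hasFDerivWithinAt (s := Set.range I)
  rw [← extChartAt_apply (a.mem_source x)] at hx hsymm ⊢
  change D = _
  exact (I.uniqueDiffOn _ ((a.chart x).target_subset hx)).eq hcoe (hsymm.congr_of_eventuallyEq
    (coe_comp_extChartAt_symm_eventuallyEq x) (coe_extChartAt_symm hx))

theorem injective_mfderiv_coe (x : a.Carrier) :
    Function.Injective (mfderiv I 𝓘(ℝ, E) (fun x : a.Carrier => (x : E)) x : F →L[ℝ] E) := by
  rw [mfderiv_coe]
  exact Function.LeftInverse.injective
    (DFunLike.congr_fun ((a.chart x).fderiv_comp_fderiv_symm (a.mem_source x)))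

variable {F' : Type*} [NormedAddCommGroup F'] [NormedSpace ℝ F'] {H' : Type*}
  [TopologicalSpace H'] {J : ModelWithCorners ℝ F' H'} {N : Type*} [TopologicalSpace N]
  [ChartedSpace H' N]

theorem contMDiff_of_coe_comp {f : N → a.Carrier}
    (hf : ContMDiff J 𝓘(ℝ, E) ∞ fun x => (f x : E)) : ContMDiff J I ∞ f := by
  have hfc : Continuous f := Topology.IsInducing.subtypeVal.continuous_iff.2 hf.continuous
  intro x
  refine contMDiffAt_iff_target.2 ⟨hfc.continuousAt, ?_⟩
  refine (((a.chart (f x)).contDiffAt _ (a.mem_source (f x))).contMDiffAt.comp x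
    (hf x)).congr_of_eventuallyEq ?_
  filter_upwards [hfc.continuousAt ((chartAt H (f x)).open_source.mem_nhds
    (mem_chart_source H (f x)))] with y hy
  exact extChartAt_apply hy

end AmbientAtlas

end AmbientAtlases

section BallInversion

open EuclideanGeometry

theorem norm_add_sq_pos_of_ne_neg {E : Type*} [NormedAddCommGroup E] {v x : E} (hx : x ≠ -v) :
    0 < ‖x + v‖ ^ 2 :=
  pow_pos (norm_pos_iff.2 (mt eq_neg_of_add_eq_zero_left hx)) 2

variable {E : Type*} [NormedAddCommGroup E] [InnerProductSpace ℝ E]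

/-- The inversion of centre `-v` that, for a unit vector `v`, exchanges the closed unit ball without
the point `-v` and the half-space of the vectors `y` with `0 ≤ ⟪v, y⟫`. -/
def ballInversion (v : E) : E → E := inversion (-v) √2

variable {v : E}

theorem ballInversion_involutive (v : E) : Function.Involutive (ballInversion v) :=
  inversion_involutive (-v) (Real.sqrt_ne_zero'.2 two_pos)

theorem ballInversion_eq_neg_iff {x : E} : ballInversion v x = -v ↔ x = -v :=
  inversion_eq_center (Real.sqrt_ne_zero'.2 two_pos)

theorem contDiffAt_ballInversion {n : ℕ∞} {x : E} (hx : x ≠ -v) :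
    ContDiffAt ℝ n (ballInversion v) x :=
  contDiffAt_const.inversion contDiffAt_const contDiffAt_id hx

variable (hv : ‖v‖ = 1)
include hv

theorem ne_neg_of_inner_nonneg {y : E} (hy : 0 ≤ inner ℝ v y) : y ≠ -v := by
  rintro rfl
  rw [inner_neg_right, real_inner_self_eq_norm_sq, hv] at hy
  norm_num at hy

theorem inner_ballInversion {x : E} (hx : x ≠ -v) :
    inner ℝ v (ballInversion v x) = (1 - ‖x‖ ^ 2) / ‖x + v‖ ^ 2 := by
  have hpos := norm_add_sq_pos_of_ne_neg hx
  have hnorm : ‖x + v‖ ^ 2 = ‖x‖ ^ 2 + 2 * inner ℝ v x + 1 := by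
    rw [norm_add_sq_real, hv, real_inner_comm, one_pow]
  rw [ballInversion, inversion, dist_eq_norm, vsub_eq_sub, vadd_eq_add, sub_neg_eq_add,
    inner_add_right, inner_smul_right, inner_neg_right, inner_add_right,
    real_inner_self_eq_norm_sq, hv, div_pow, Real.sq_sqrt zero_le_two]
  generalize ‖x + v‖ ^ 2 = N at hpos hnorm ⊢
  field_simp
  rw [hnorm]
  ring

theorem inner_ballInversion_nonneg_iff {x : E} (hx : x ≠ -v) :
    0 ≤ inner ℝ v (ballInversion v x) ↔ ‖x‖ ≤ 1 := by
  rw [inner_ballInversion hv hx, le_div_iff₀ (norm_add_sq_pos_of_ne_neg hx), zero_mul, sub_nonneg,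
    sq_le_one_iff₀ (norm_nonneg x)]

theorem inner_ballInversion_eq_zero_iff {x : E} (hx : x ≠ -v) :
    inner ℝ v (ballInversion v x) = 0 ↔ ‖x‖ = 1 := by
  rw [inner_ballInversion hv hx, div_eq_zero_iff, or_iff_left (norm_add_sq_pos_of_ne_neg hx).ne',
    sub_eq_zero, eq_comm, pow_eq_one_iff_of_nonneg (norm_nonneg x) two_ne_zero]

theorem ballInversion_self : ballInversion v v = 0 := by
  have hscale : (√2 / ‖(2 : ℝ) • v‖) ^ 2 = (2 : ℝ)⁻¹ := by
    rw [norm_smul, hv, div_pow, Real.sq_sqrt zero_le_two]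
    norm_num
  rw [ballInversion, inversion, dist_eq_norm, vsub_eq_sub, vadd_eq_add, sub_neg_eq_add,
    ← two_smul ℝ v, hscale, inv_smul_smul₀ two_ne_zero, add_neg_cancel]

theorem inner_fderiv_ballInversion_zero (w : E) :
    inner ℝ v (fderiv ℝ (ballInversion v) 0 w) = -2 * inner ℝ v w := by
  have hderiv := hasFDerivAt_inversion (R := √2) (ne_neg_of_inner_nonneg hv (inner_zero_right v).ge)
  rw [sub_neg_eq_add, dist_eq_norm, sub_neg_eq_add, zero_add, hv, div_one,
    Real.sq_sqrt zero_le_two] at hderiv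
  calc
    inner ℝ v (fderiv ℝ (ballInversion v) 0 w) = 2 * inner ℝ v ((ℝ ∙ v)ᗮ.reflection w) := by
      rw [ballInversion, hderiv.fderiv, ← inner_smul_right]
      rfl
    _ = 2 * inner ℝ ((ℝ ∙ v)ᗮ.reflection v) w := by
      rw [← LinearIsometryEquiv.inner_map_map (ℝ ∙ v)ᗮ.reflection, Submodule.reflection_reflection]
    _ = -2 * inner ℝ v w := by
      rw [Submodule.reflection_orthogonalComplement_singleton_eq_neg, inner_neg_left]
      ring

end BallInversion

section Disc

theorem range_halfSpaceModel (d : ℕ) : Set.range (halfSpaceModel d) = {y | 0 ≤ y.2 0} := by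
  rw [modelWithCorners_prod_coe, Set.range_prodMap, range_modelWithCornersEuclideanHalfSpace,
    modelWithCornersSelf_coe, Set.range_id, Set.univ_prod]
  rfl

theorem frontier_range_halfSpaceModel (d : ℕ) :
    frontier (Set.range (halfSpaceModel d)) = {y | y.2 0 = 0} := by
  rw [modelWithCorners_prod_coe, Set.range_prodMap, modelWithCornersSelf_coe, Set.range_id,
    frontier_univ_prod_eq, frontier_range_modelWithCornersEuclideanHalfSpace, Set.univ_prod]
  exact Set.ext fun y => eq_comm

variable {d : ℕ}

/-- The last standard basis vector. -/
def northPole (d : ℕ) : EuclideanSpace ℝ (Fin (d + 1)) := EuclideanSpace.single (Fin.last d) 1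

theorem norm_northPole (d : ℕ) : ‖northPole d‖ = 1 := by
  rw [northPole, PiLp.norm_single, norm_one]

/-- Linear coordinates whose last entry is, for a unit vector `v`, the component along `v`. -/
def heightCoordinates (v : EuclideanSpace ℝ (Fin (d + 1))) :
    EuclideanSpace ℝ (Fin (d + 1)) ≃L[ℝ] EuclideanSpace ℝ (Fin d) × EuclideanSpace ℝ (Fin 1) :=
  (ℝ ∙ (v - northPole d))ᗮ.reflection.toContinuousLinearEquiv.trans
    EuclideanSpace.finAddEquivProd

theorem heightCoordinates_snd_zero {v : EuclideanSpace ℝ (Fin (d + 1))} (hv : ‖v‖ = 1)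
    (z : EuclideanSpace ℝ (Fin (d + 1))) : (heightCoordinates v z).2 0 = inner ℝ v z :=
  calc
    (heightCoordinates v z).2 0 = (ℝ ∙ (v - northPole d))ᗮ.reflection z (Fin.last d) := rfl
    _ = inner ℝ (northPole d) ((ℝ ∙ (v - northPole d))ᗮ.reflection z) := by
      rw [northPole, EuclideanSpace.inner_single_left, map_one, one_mul]
    _ = inner ℝ v z := by
      nth_rw 1 [← Submodule.reflection_sub (hv.trans (norm_northPole d).symm)]
      exact LinearIsometryEquiv.inner_map_map _ _ _

theorem inner_heightCoordinates_symm {v : EuclideanSpace ℝ (Fin (d + 1))} (hv : ‖v‖ = 1)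
    (y : EuclideanSpace ℝ (Fin d) × EuclideanSpace ℝ (Fin 1)) :
    inner ℝ v ((heightCoordinates v).symm y) = y.2 0 := by
  rw [← heightCoordinates_snd_zero hv, ContinuousLinearEquiv.apply_symm_apply]

/-- The chart of the closed unit disc, defined away from `-v`, that maps it to a half-space. -/
def discChart (v : EuclideanSpace ℝ (Fin (d + 1))) (hv : ‖v‖ = 1) :
    AmbientChart (halfSpaceModel d) (Metric.closedBall (0 : EuclideanSpace ℝ (Fin (d + 1))) 1) where
  toFun x := heightCoordinates v (ballInversion v x)
  invFun y := ballInversion v ((heightCoordinates v).symm y)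
  source := Metric.closedBall 0 1 \ {-v}
  target := Set.range (halfSpaceModel d)
  map_source' := by
    rintro x ⟨hx, hxv⟩
    rwa [range_halfSpaceModel, Set.mem_ofPred_eq, heightCoordinates_snd_zero hv,
      inner_ballInversion_nonneg_iff hv hxv, ← mem_closedBall_zero_iff]
  map_target' y hy := by
    rw [range_halfSpaceModel, Set.mem_ofPred_eq, ← inner_heightCoordinates_symm hv] at hy
    have hne : ballInversion v ((heightCoordinates v).symm y) ≠ -v :=
      mt ballInversion_eq_neg_iff.1 (ne_neg_of_inner_nonneg hv hy)
    refine ⟨mem_closedBall_zero_iff.2 ((inner_ballInversion_nonneg_iff hv hne).1 ?_), hne⟩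
    rwa [ballInversion_involutive v]
  left_inv' x _ := by
    rw [ContinuousLinearEquiv.symm_apply_apply, ballInversion_involutive v]
  right_inv' y _ := by
    rw [ballInversion_involutive v, ContinuousLinearEquiv.apply_symm_apply]
  source_subset := Set.sdiff_subset
  target_subset := subset_rfl
  isOpen_source := by
    rw [Set.preimage_sdiff, Subtype.coe_preimage_self, ← Set.compl_eq_univ_sdiff]
    exact (isClosed_singleton.preimage continuous_subtype_val).isOpen_compl
  isOpen_target := by
    rw [Set.preimage_range]
    exact isOpen_univ
  contDiffAt x hx := (heightCoordinates v).contDiff.contDiffAt.comp x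
    (contDiffAt_ballInversion hx.2)
  contDiffAt_symm y hy := by
    rw [range_halfSpaceModel, Set.mem_ofPred_eq, ← inner_heightCoordinates_symm hv] at hy
    exact (contDiffAt_ballInversion (ne_neg_of_inner_nonneg hv hy)).comp y
      (heightCoordinates v).symm.contDiff.contDiffAt

/-- The centre of the chart of the closed unit disc around `x`; a boundary point is the centre of
its own chart. -/
def discChartCenter (x : EuclideanSpace ℝ (Fin (d + 1))) : EuclideanSpace ℝ (Fin (d + 1)) :=
  if ‖x‖ = 1 then x else northPole d

theorem norm_discChartCenter (x : EuclideanSpace ℝ (Fin (d + 1))) : ‖discChartCenter x‖ = 1 := by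
  rw [discChartCenter]
  split_ifs with hx
  exacts [hx, norm_northPole d]

theorem ne_neg_discChartCenter (x : EuclideanSpace ℝ (Fin (d + 1))) : x ≠ -discChartCenter x := by
  rw [discChartCenter]
  split_ifs with hx
  · exact ne_neg_of_inner_nonneg hx real_inner_self_nonneg
  · rintro rfl
    exact hx ((norm_neg _).trans (norm_northPole d))

/-- The charts of the closed unit disc, with `discChart (discChartCenter x)` around `x`. -/
def discAtlas (d : ℕ) :
    AmbientAtlas (halfSpaceModel d) (Metric.closedBall (0 : EuclideanSpace ℝ (Fin (d + 1))) 1) where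
  chart x := discChart (discChartCenter x.1) (norm_discChartCenter x.1)
  mem_source x := ⟨x.2, ne_neg_discChartCenter x.1⟩

/-- The closed unit disc as a manifold with boundary. -/
abbrev Disc (d : ℕ) : Type := (discAtlas d).Carrier

instance : Nonempty (Metric.closedBall (0 : EuclideanSpace ℝ (Fin (d + 1))) 1) :=
  ⟨⟨0, Metric.mem_closedBall_self zero_le_one⟩⟩

instance : CompactSpace (Disc d) :=
  inferInstanceAs (CompactSpace (Metric.closedBall (0 : EuclideanSpace ℝ (Fin (d + 1))) 1))

instance : T2Space (Disc d) :=
  inferInstanceAs (T2Space (Metric.closedBall (0 : EuclideanSpace ℝ (Fin (d + 1))) 1))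

theorem mem_boundary_disc_iff (x : Disc d) :
    x ∈ (halfSpaceModel d).boundary (Disc d) ↔ ‖(x : EuclideanSpace ℝ (Fin (d + 1)))‖ = 1 := by
  change extChartAt (halfSpaceModel d) x x ∈ frontier _ ↔ _
  rw [AmbientAtlas.extChartAt_apply ((discAtlas d).mem_source x), frontier_range_halfSpaceModel]
  change (heightCoordinates _ (ballInversion _ _)).2 0 = 0 ↔ _
  rw [heightCoordinates_snd_zero (norm_discChartCenter _),
    inner_ballInversion_eq_zero_iff (norm_discChartCenter _) (ne_neg_discChartCenter _)]

/-- The derivative of the inclusion of the closed unit disc. -/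
def discDeriv (x : Disc d) :
    EuclideanSpace ℝ (Fin d) × EuclideanSpace ℝ (Fin 1) →L[ℝ] EuclideanSpace ℝ (Fin (d + 1)) :=
  mfderiv (halfSpaceModel d) 𝓘(ℝ, EuclideanSpace ℝ (Fin (d + 1))) (fun x : Disc d => x.1) x

theorem inner_discDeriv {x : Disc d} (hx : ‖(x : EuclideanSpace ℝ (Fin (d + 1)))‖ = 1)
    (w : EuclideanSpace ℝ (Fin d) × EuclideanSpace ℝ (Fin 1)) :
    inner ℝ (x : EuclideanSpace ℝ (Fin (d + 1))) (discDeriv x w) = -2 * w.2 0 := by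
  have hcenter : discChartCenter (x : EuclideanSpace ℝ (Fin (d + 1))) = x := if_pos hx
  have hderiv : discDeriv x = fderiv ℝ (ballInversion x.1) 0 ∘L
      ((heightCoordinates x.1).symm : _ →L[ℝ] EuclideanSpace ℝ (Fin (d + 1))) := by
    rw [discDeriv, AmbientAtlas.mfderiv_coe]
    change fderiv ℝ (ballInversion (discChartCenter x.1) ∘ (heightCoordinates _).symm)
      (heightCoordinates _ (ballInversion _ x.1)) = _
    rw [hcenter, ContinuousLinearEquiv.comp_right_fderiv, ContinuousLinearEquiv.symm_apply_apply,
      ballInversion_self hx]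
  rw [hderiv, ContinuousLinearMap.comp_apply, inner_fderiv_ballInversion_zero hx,
    ContinuousLinearEquiv.coe_coe, inner_heightCoordinates_symm hx]

end Disc

section DiscCobordism

variable {d : ℕ}

instance : Fact (Module.finrank ℝ (EuclideanSpace ℝ (Fin (d + 1))) = d + 1) :=
  ⟨finrank_euclideanSpace_fin⟩

/-- The standard volume form of Euclidean space. -/
def volForm (d : ℕ) : EuclideanSpace ℝ (Fin (d + 1)) [⋀^Fin (d + 1)]→ₗ[ℝ] ℝ :=
  (EuclideanSpace.basisFun (Fin (d + 1)) ℝ).toBasis.det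

theorem volForm_ne_zero (d : ℕ) : volForm d ≠ 0 :=
  Module.Basis.det_ne_zero _

theorem volForm_zero_apply (u : Fin 1 → EuclideanSpace ℝ (Fin 1)) : volForm 0 u = u 0 0 := by
  rw [volForm, Module.Basis.det_apply, Matrix.det_fin_one, Module.Basis.toMatrix_apply,
    OrthonormalBasis.coe_toBasis_repr_apply, EuclideanSpace.basisFun_repr]

/-- The derivative of the inclusion of the unit sphere. -/
def sphereDeriv (x : Metric.sphere (0 : EuclideanSpace ℝ (Fin (d + 1))) 1) :
    EuclideanSpace ℝ (Fin d) →L[ℝ] EuclideanSpace ℝ (Fin (d + 1)) :=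
  mfderiv (𝓡 d) 𝓘(ℝ, EuclideanSpace ℝ (Fin (d + 1))) Subtype.val x

theorem mem_range_sphereDeriv_iff {x : Metric.sphere (0 : EuclideanSpace ℝ (Fin (d + 1))) 1}
    {w : EuclideanSpace ℝ (Fin (d + 1))} :
    w ∈ (sphereDeriv x).toLinearMap.range ↔ inner ℝ x.1 w = 0 := by
  rw [← Submodule.mem_orthogonal_singleton_iff_inner_right, ← range_mvfderiv_subtypeVal (n := d) x]
  rfl

theorem volForm_compLinearMap_discDeriv_ne_zero (x : Disc d) :
    (volForm d).compLinearMap (discDeriv x).toLinearMap ≠ 0 := by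
  let e := LinearMap.linearEquivOfInjective (discDeriv x).toLinearMap
    (AmbientAtlas.injective_mfderiv_coe x) (by simp)
  exact mt ((volForm d).compLinearEquiv_eq_zero_iff e).1 (volForm_ne_zero d)

theorem volForm_curryLeft_compLinearMap_sphereDeriv_ne_zero
    (x : Metric.sphere (0 : EuclideanSpace ℝ (Fin (d + 1))) 1) :
    ((volForm d).curryLeft x.1).compLinearMap (sphereDeriv x).toLinearMap ≠ 0 := by
  have hinj : Function.Injective (sphereDeriv x).toLinearMap :=
    injective_mvfderiv_subtypeVal_sphere x
  refine curryLeft_compLinearMap_ne_zero (volForm_ne_zero d) finrank_euclideanSpace_fin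
    finrank_euclideanSpace_fin hinj ?_
  rw [mem_range_sphereDeriv_iff, inner_self_eq_zero]
  exact ne_zero_of_mem_unit_sphere x

instance : IsManifold (𝓡 d) ∞ (Metric.sphere (0 : EuclideanSpace ℝ (Fin (d + 1))) 1) :=
  IsManifold.of_le (n := ω) le_top

/-- The unit sphere, with the orientation for which the outward normal vector followed by a
positive basis is positive. -/
def unitSphere (d : ℕ) : ClosedManifold d where
  carrier := Metric.sphere (0 : EuclideanSpace ℝ (Fin (d + 1))) 1
  orientation x := rayOfNeZero ℝ _ (volForm_curryLeft_compLinearMap_sphereDeriv_ne_zero x)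
  orientation_cont := by
    refine isContinuousOrientation_compLinearMap_mfderiv
      (EuclideanSpace.basisFun (Fin d) ℝ).toBasis contMDiff_coe_sphere
      (η := fun x => (volForm d).curryLeft x.1) ?_
      volForm_curryLeft_compLinearMap_sphereDeriv_ne_zero
    exact (continuous_basis_det _).comp
      ((continuous_subtype_val.comp continuous_fst).matrixVecCons continuous_snd)

/-- The inclusion of the unit sphere into the closed unit disc. -/
def sphereToDisc (d : ℕ) : Metric.sphere (0 : EuclideanSpace ℝ (Fin (d + 1))) 1 → Disc d :=
  Set.inclusion Metric.sphere_subset_closedBall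

theorem contMDiff_sphereToDisc : ContMDiff (𝓡 d) (halfSpaceModel d) ∞ (sphereToDisc d) :=
  AmbientAtlas.contMDiff_of_coe_comp contMDiff_coe_sphere

theorem discDeriv_comp_mfderiv_sphereToDisc
    (x : Metric.sphere (0 : EuclideanSpace ℝ (Fin (d + 1))) 1) :
    (discDeriv (sphereToDisc d x)).toLinearMap ∘ₗ
      (mfderiv (𝓡 d) (halfSpaceModel d) (sphereToDisc d) x).toLinearMap =
        (sphereDeriv x).toLinearMap := by
  ext1 u
  exact (mfderiv_comp_apply x (AmbientAtlas.contMDiff_coe.mdifferentiableAt (by simp))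
    (contMDiff_sphereToDisc.mdifferentiableAt (by simp)) u).symm

theorem inducesOrientation_sphereToDisc
    (x : Metric.sphere (0 : EuclideanSpace ℝ (Fin (d + 1))) 1)
    (v : EuclideanSpace ℝ (Fin d) × EuclideanSpace ℝ (Fin 1)) (hv : v.2 0 < 0) :
    InducesOrientation (mfderiv (𝓡 d) (halfSpaceModel d) (sphereToDisc d) x).toLinearMap v
      ((unitSphere d).orientation x)
      (rayOfNeZero ℝ _ (volForm_compLinearMap_discDeriv_ne_zero (sphereToDisc d x))) := by
  have hnormal : discDeriv (sphereToDisc d x) v - (-2 * v.2 0) • x.1 ∈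
      (sphereDeriv x).toLinearMap.range := by
    have hx : ‖(x : EuclideanSpace ℝ (Fin (d + 1)))‖ = 1 := norm_eq_of_mem_sphere x
    rw [mem_range_sphereDeriv_iff, inner_sub_right, inner_smul_right, real_inner_self_eq_norm_sq,
      hx, one_pow, mul_one, sub_eq_zero]
    exact inner_discDeriv (x := sphereToDisc d x) hx v
  let L : EuclideanSpace ℝ (Fin d) →L[ℝ] EuclideanSpace ℝ (Fin d) × EuclideanSpace ℝ (Fin 1) :=
    mfderiv (𝓡 d) (halfSpaceModel d) (sphereToDisc d) x
  exact inducesOrientation_rayOfNeZero (L := L.toLinearMap) (by simp) (by linarith)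
    (discDeriv_comp_mfderiv_sphereToDisc x) hnormal _ _

/-- The closed unit disc as a cobordism from the empty manifold to the sphere. -/
def unitDisc (d : ℕ) : Cobordism (ClosedManifold.empty d) (unitSphere d) where
  carrier := Disc d
  orientation x := rayOfNeZero ℝ _ (volForm_compLinearMap_discDeriv_ne_zero x)
  orientation_cont := by
    refine isContinuousOrientation_compLinearMap_mfderiv
      (Module.finBasisOfFinrankEq ℝ (EuclideanSpace ℝ (Fin d) × EuclideanSpace ℝ (Fin 1)) (by simp))
      AmbientAtlas.contMDiff_coe (η := fun _ => volForm d) ?_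
      volForm_compLinearMap_discDeriv_ne_zero
    exact (continuous_basis_det _).comp continuous_snd
  inMap := isEmptyElim
  outMap := sphereToDisc d
  inMap_smooth := isEmptyElim
  outMap_smooth := contMDiff_sphereToDisc
  inMap_injective := isEmptyElim
  outMap_injective := Set.inclusion_injective Metric.sphere_subset_closedBall
  disjoint_range := Set.disjoint_range_iff.2 isEmptyElim
  range_union := by
    rw [Set.range_eq_empty, Set.empty_union]
    ext x
    rw [mem_boundary_disc_iff, ← mem_sphere_zero_iff_norm]
    exact ⟨fun ⟨y, hy⟩ => hy ▸ y.2, fun hx => ⟨⟨x.1, hx⟩, rfl⟩⟩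
  inMap_orientation := isEmptyElim
  outMap_orientation := inducesOrientation_sphereToDisc

end DiscCobordism

section SphereInvariants

open MultiplicativeInvariant

instance (d : ℕ) : ConnectedSpace (unitSphere (d + 1)) := by
  refine isConnected_iff_connectedSpace.1 (isConnected_sphere ?_ 0 zero_le_one)
  rw [← Module.finrank_eq_rank, finrank_euclideanSpace_fin]
  exact_mod_cast Nat.one_lt_succ_succ d

theorem isPositive_unitSphere_zero_iff
    (x : Metric.sphere (0 : EuclideanSpace ℝ (Fin (0 + 1))) 1) :
    (unitSphere 0).IsPositive x ↔ x.1 = EuclideanSpace.single 0 1 := by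
  have hsingle : x.1 = EuclideanSpace.single 0 (x.1 0) := by
    ext i
    rw [Fin.fin_one_eq_zero i, PiLp.single_apply, if_pos rfl]
  have habs : |x.1 0| = 1 :=
    calc
      |x.1 0| = ‖EuclideanSpace.single (0 : Fin (0 + 1)) (x.1 0)‖ := by
        rw [PiLp.norm_single, Real.norm_eq_abs]
      _ = 1 := by rw [← hsingle, norm_eq_of_mem_sphere]
  have happly : ((volForm 0).curryLeft x.1).compLinearMap (sphereDeriv x).toLinearMap 0 = x.1 0 :=
    volForm_zero_apply _
  refine (rayOfNeZero_eq_positiveOrientation_iff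
    (volForm_curryLeft_compLinearMap_sphereDeriv_ne_zero x)).trans ?_
  rw [happly]
  constructor
  · intro h
    rw [hsingle, (abs_of_pos h).symm.trans habs]
  · intro h
    rw [h, PiLp.single_apply, if_pos rfl]
    exact one_pos

theorem card_isPositive_unitSphere_zero : Nat.card {x // (unitSphere 0).IsPositive x} = 1 := by
  have hone : EuclideanSpace.single 0 1 ∈ Metric.sphere (0 : EuclideanSpace ℝ (Fin (0 + 1))) 1 :=
    mem_sphere_zero_iff_norm.2 (by rw [PiLp.norm_single, norm_one])
  refine Nat.card_eq_one_iff_exists.2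
    ⟨⟨⟨_, hone⟩, (isPositive_unitSphere_zero_iff ⟨_, hone⟩).2 rfl⟩, fun y => ?_⟩
  exact Subtype.ext (Subtype.ext ((isPositive_unitSphere_zero_iff y.1).1 y.2))

theorem exists_multiplicativeInvariant_unitSphere_eq {G : Type*} [CommMonoid G] (d : ℕ) (u : G) :
    ∃ f : MultiplicativeInvariant d G, f (unitSphere d) = u := by
  cases d with
  | zero =>
    refine ⟨powCardPositive u, ?_⟩
    change u ^ Nat.card _ = u
    rw [card_isPositive_unitSphere_zero, pow_one]
  | succ d =>
    refine ⟨powCardComponents (d + 1) u, ?_⟩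
    change u ^ Nat.card _ = u
    rw [Nat.card_unique, pow_one]

end SphereInvariants

end

theorem mainTheorem3 (k : Type*) [Field k] (d : ℕ) :
    trivialOnClosed k d = ⊥ ↔ Subsingleton kˣ := by
  constructor
  · intro h
    refine subsingleton_of_forall_eq 1 fun u => ?_
    obtain ⟨f, hf⟩ := exists_multiplicativeInvariant_unitSphere_eq d u
    calc
      u = f (unitSphere d) := hf.symm
      _ = f (ClosedManifold.empty d) :=
        (InvertibleTQFT.eq_of_trivialOnClosed_eq_bot h f (unitDisc d)).symm
      _ = 1 := f.map_of_isEmpty _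
  · exact fun _ => Subsingleton.elim _ _
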